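/- Let $S$ be a quantum system with a non-zero finite-dimensional Hilbert space $\mathbb{C}^n$, let $H_0, H_\tau$ be Hermitian operators (the initial and final Hamiltonians) and let $\beta>0$. For $t\in\{0,\tau\}$ let $F_t=-\beta^{-1}\ln\operatorname{Tr}e^{-\beta H_t}$ be the free energy and $\Gamma_t=e^{\beta(F_t-H_t)}$ the equilibrium state. Let $\Phi$ be any completely positive trace-preserving (CPTP) linear map on the operators of $S$, and let $\Phi^\dagger$ be its trace-dual, $\operatorname{Tr}[\Phi(X)Y]=\operatorname{Tr}[X\Phi^\dagger(Y)]$ for all $X,Y$. For the process that starts in $\Gamma_0$ put $\Delta E=\operatorname{Tr}[\Phi(\Gamma_0)H_\tau]-\operatorname{Tr}[\Gamma_0H_0]$ and $\Delta F=F_\tau-F_0$. Let $\mathcal{L}(\rho,\sigma)=\arccos\mathsf{F}(\rho,\sigma)$ be the Bures angle, where $\mathsf{F}(\rho,\sigma)=\lVert\sqrt{\rho}\sqrt{\sigma}\rVert_1$ is the fidelity ($\lVert\cdot\rVert_1$ is the trace norm). Then: 1. $\operatorname{Tr}\Phi^\dagger(\Gamma_\tau)>0$, and $\gamma:=\Phi^\dagger(\Gamma_\tau)/\operatorname{Tr}\Phi^\dagger(\Gamma_\tau)$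 (the normalized retrodicted state) is a density matrix. 2. $\beta(\Delta E-\Delta F)\ \ge\ \frac{8}{\pi^2}\,\mathcal{L}^2(\Gamma_0,\gamma)-\ln\operatorname{Tr}\Phi^\dagger(\Gamma_\tau)$. 3. If $\Phi$ is unitary, $\Phi(X)=UXU^\dagger$ for all $X$ with $U$ unitary, then the right-hand side of 2 equals $\frac{8}{\pi^2}\mathcal{L}^2(\Phi(\Gamma_0),\Gamma_\tau)$, so that 2 becomes the Deffner–Lutz bound $\beta(\Delta E-\Delta F)\ge\frac{8}{\pi^2}\mathcal{L}^2(\Phi(\Gamma_0),\Gamma_\tau)$. 4. If $\Phi$ is unital, $\Phi(\mathbb{1})=\mathbb{1}$, then $\operatorname{Tr}\Phi^\dagger(\Gamma_\tau)=1$ and $\gamma=\Phi^\dagger(\Gamma_\tau)$, so that 2 becomes $\beta(\Delta E-\Delta F)\ge\frac{8}{\pi^2}\mathcal{L}^2(\Gamma_0,\Phi^\dagger(\Gamma_\tau))$. -/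

import Mathlib

/-!
Finite-dimensional quantum systems: operators on the state space `ℂⁿ` of the system are complex
matrices indexed by a finite type `n`.
-/

open scoped ComplexOrder

noncomputable section

namespace QThermo

section Channel

open scoped MatrixOrder Matrix.Norms.L2Operator

/-- A completely positive trace-preserving linear map on the operators of the system `ℂⁿ`
(complete positivity is Mathlib's, for the C⋆-algebra of `n × n` matrices with the operator norm
and the Loewner order). -/
structure CPTPMap (n : Type*) [Fintype n] [DecidableEq n] extends
    CompletelyPositiveMap (Matrix n n ℂ) (Matrix n n ℂ) where
  trace_map' : ∀ X : Matrix n n ℂ, (toFun X).trace = X.trace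

/-- The linear map on matrices underlying a channel. -/
def CPTPMap.toLin {n : Type*} [Fintype n] [DecidableEq n] (Φ : CPTPMap n) :
    Matrix n n ℂ →ₗ[ℂ] Matrix n n ℂ :=
  Φ.toCompletelyPositiveMap.toLinearMap

end Channel

variable {n : Type*} [Fintype n] [DecidableEq n]

instance : CoeFun (CPTPMap n) (fun _ => Matrix n n ℂ → Matrix n n ℂ) := ⟨fun Φ => Φ.toLin⟩

/-- The trace-dual `Φ†` of a linear map `Φ` on matrices, given by its matrix entries
`Φ†(Y) i j = Tr[Φ(|j⟩⟨i|) Y]`. -/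
def traceDual (Φ : Matrix n n ℂ →ₗ[ℂ] Matrix n n ℂ) : Matrix n n ℂ →ₗ[ℂ] Matrix n n ℂ where
  toFun Y := Matrix.of fun i j => (Φ (Matrix.single j i 1) * Y).trace
  map_add' Y Z := by ext i j; simp [Matrix.mul_add]
  map_smul' c Y := by ext i j; simp

/-- The defining property of the trace-dual: `Tr[Φ(X) Y] = Tr[X Φ†(Y)]` for all `X`, `Y`. -/
theorem trace_map_mul (Φ : Matrix n n ℂ →ₗ[ℂ] Matrix n n ℂ) (X Y : Matrix n n ℂ) :
    (Φ X * Y).trace = (X * traceDual Φ Y).trace := by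
  have h : Φ X = ∑ i, ∑ j, X i j • Φ (Matrix.single i j 1) := by
    conv_lhs => rw [Matrix.matrix_eq_sum_single X]
    simp only [map_sum]
    refine Finset.sum_congr rfl fun i _ => Finset.sum_congr rfl fun j _ => ?_
    rw [← map_smul, Matrix.smul_single, smul_eq_mul, mul_one]
  rw [h]
  simp only [Matrix.sum_mul, Matrix.trace_sum, Matrix.smul_mul, Matrix.trace_smul, smul_eq_mul]
  rw [Matrix.trace]
  refine Finset.sum_congr rfl fun i _ => ?_
  rw [Matrix.diag_apply, Matrix.mul_apply]
  rfl

/-- The free energy `F = -β⁻¹ ln Tr exp(-β H)` of the Hamiltonian `H` at inverse temperature `β`. -/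
def freeEnergy (β : ℝ) (H : Matrix n n ℂ) : ℝ :=
  -β⁻¹ * Real.log (NormedSpace.exp (-(β : ℂ) • H)).trace.re

/-- The equilibrium state `Γ = exp[β (F - H)]`. -/
def gibbs (β : ℝ) (H : Matrix n n ℂ) : Matrix n n ℂ :=
  NormedSpace.exp ((β : ℂ) • ((freeEnergy β H : ℂ) • (1 : Matrix n n ℂ) - H))

/-- The average energy `Tr[ρ H]` (a real number for Hermitian `ρ` and `H`). -/
def energy (ρ H : Matrix n n ℂ) : ℝ := (ρ * H).trace.re

/-- Density matrices: positive semidefinite matrices of unit trace. -/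
def IsDensity (ρ : Matrix n n ℂ) : Prop := ρ.PosSemidef ∧ ρ.trace = 1

section Fidelity

open scoped MatrixOrder

/-- The trace norm `‖A‖₁ = Tr √(A† A)`. -/
def traceNorm (A : Matrix n n ℂ) : ℝ := (CFC.sqrt (A.conjTranspose * A)).trace.re

/-- The fidelity `F(ρ, σ) = ‖√ρ √σ‖₁`. -/
def fidelity (ρ σ : Matrix n n ℂ) : ℝ := traceNorm (CFC.sqrt ρ * CFC.sqrt σ)

end Fidelity

/-- The Bures angle `L(ρ, σ) = arccos F(ρ, σ)`. -/
def buresAngle (ρ σ : Matrix n n ℂ) : ℝ := Real.arccos (fidelity ρ σ)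

/-- The normalized retrodicted state `Φ†(σ) / Tr Φ†(σ)`. -/
def retrodicted (Φ : CPTPMap n) (σ : Matrix n n ℂ) : Matrix n n ℂ :=
  (traceDual Φ.toLin σ).trace⁻¹ • traceDual Φ.toLin σ

/-- `ΔE - ΔF` for the process `Φ` started in the equilibrium state `Γ₀` of `H₀`, with final
Hamiltonian `Hτ`: here `ΔE = Tr[Φ(Γ₀) Hτ] - Tr[Γ₀ H₀]` and `ΔF = Fτ - F₀`. -/
def excessEnergy (Φ : CPTPMap n) (β : ℝ) (H₀ Hτ : Matrix n n ℂ) : ℝ :=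
  (energy (Φ (gibbs β H₀)) Hτ - energy (gibbs β H₀) H₀) - (freeEnergy β Hτ - freeEnergy β H₀)

end QThermo

end

open QThermo

namespace QThermo

theorem cos_le_exp_neg_sq_div_two {x : ℝ} (h0 : 0 ≤ x) (h1 : x ≤ Real.pi / 2) :
    Real.cos x ≤ Real.exp (-(x ^ 2 / 2)) := by
  have hd : ∀ y : ℝ, HasDerivAt (fun y => Real.exp (y ^ 2 / 2) * Real.cos y)
      (Real.exp (y ^ 2 / 2) * y * Real.cos y + Real.exp (y ^ 2 / 2) * -Real.sin y) y := fun y => by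
    have h : HasDerivAt (fun y : ℝ => y ^ 2 / 2) y y := by
      simpa using (hasDerivAt_pow 2 y).div_const 2
    exact h.exp.mul (Real.hasDerivAt_cos y)
  have hanti : AntitoneOn (fun y => Real.exp (y ^ 2 / 2) * Real.cos y)
      (Set.Icc 0 (Real.pi / 2)) := by
    refine antitoneOn_of_deriv_nonpos (convex_Icc _ _)
      (fun y _ => (hd y).continuousAt.continuousWithinAt)
      (fun y _ => (hd y).differentiableAt.differentiableWithinAt) fun y hy => ?_
    rw [interior_Icc] at hy
    have hc : 0 < Real.cos y := Real.cos_pos_of_mem_Ioo ⟨by linarith [hy.1], hy.2⟩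
    have ht : y * Real.cos y ≤ Real.sin y := by
      have := Real.lt_tan hy.1 hy.2
      rw [Real.tan_eq_sin_div_cos, lt_div_iff₀ hc] at this
      exact this.le
    rw [(hd y).deriv]
    nlinarith [Real.exp_pos (y ^ 2 / 2)]
  have h := hanti ⟨le_rfl, by positivity⟩ ⟨h0, h1⟩ h0
  simp only [ne_eq, OfNat.ofNat_ne_zero, not_false_eq_true, zero_pow, zero_div, Real.exp_zero,
    Real.cos_zero, mul_one] at h
  rw [Real.exp_neg, ← one_div, le_div_iff₀ (Real.exp_pos _), mul_comm]
  exact h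

/-- A lower bound on the fidelity bounds the Bures angle from above. -/
theorem arccos_sq_le_neg_two_log {f c : ℝ} (hc : 0 < c) (hc1 : c ≤ 1) (hf : c ≤ f) :
    8 / Real.pi ^ 2 * Real.arccos f ^ 2 ≤ -2 * Real.log c := by
  have hle : Real.arccos f ≤ Real.arccos c := Real.arccos_le_arccos hf
  have h2 : Real.arccos c ≤ Real.pi / 2 := Real.arccos_le_pi_div_two.2 hc.le
  have h := cos_le_exp_neg_sq_div_two (Real.arccos_nonneg c) h2
  rw [Real.cos_arccos (by linarith) hc1, ← Real.log_le_iff_le_exp hc] at h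
  have hpi : 8 / Real.pi ^ 2 ≤ 1 := by
    rw [div_le_one (by positivity)]
    nlinarith [Real.pi_gt_three]
  have hsq : Real.arccos f ^ 2 ≤ Real.arccos c ^ 2 :=
    pow_le_pow_left₀ (Real.arccos_nonneg f) hle 2
  nlinarith [sq_nonneg (Real.arccos f)]

variable {n : Type*} [Fintype n] [DecidableEq n]

theorem trace_mul_nonneg {A B : Matrix n n ℂ} (hA : A.PosSemidef) (hB : B.PosSemidef) :
    0 ≤ (A * B).trace := by
  obtain ⟨C, rfl⟩ : ∃ C : Matrix n n ℂ, A = C.conjTranspose * C := by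
    open scoped MatrixOrder Matrix.Norms.L2Operator in
    exact CStarAlgebra.nonneg_iff_eq_star_mul_self.1 hA.nonneg
  rw [Matrix.mul_assoc, Matrix.trace_mul_comm]
  exact (hB.mul_mul_conjTranspose_same C).trace_nonneg

theorem posSemidef_of_dotProduct_nonneg {A : Matrix n n ℂ}
    (h : ∀ x : n → ℂ, 0 ≤ star x ⬝ᵥ A.mulVec x) : A.PosSemidef := by
  refine .of_dotProduct_mulVec_nonneg ?_ h
  rw [← Matrix.isSymmetric_toEuclideanLin_iff, LinearMap.isSymmetric_iff_inner_map_self_real]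
  intro x
  have hx := (Complex.nonneg_iff.1 (h x)).2
  rw [inner_conj_symm, EuclideanSpace.inner_eq_star_dotProduct,
    EuclideanSpace.inner_eq_star_dotProduct, Matrix.ofLp_toLpLin, Matrix.toLin'_apply,
    dotProduct_comm, ← Complex.conj_eq_iff_im.2 hx.symm, starRingEnd_apply, Matrix.star_dotProduct,
    star_star, dotProduct_comm]

theorem exists_unitary_diagonal {H : Matrix n n ℂ} (hH : H.IsHermitian) :
    ∃ U ∈ Matrix.unitaryGroup n ℂ, H = U *
      Matrix.diagonal (fun k => (hH.eigenvalues k : ℂ)) * U.conjTranspose :=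
  ⟨hH.eigenvectorUnitary, hH.eigenvectorUnitary.2, by
    conv_lhs => rw [hH.spectral_theorem, Unitary.conjStarAlgAut_apply]
    rfl⟩

section Sqrt

open scoped MatrixOrder

theorem posSemidef_sqrt (A : Matrix n n ℂ) : (CFC.sqrt A).PosSemidef :=
  Matrix.nonneg_iff_posSemidef.1 (CFC.sqrt_nonneg A)

theorem sqrt_mul_sqrt {A : Matrix n n ℂ} (hA : A.PosSemidef) : CFC.sqrt A * CFC.sqrt A = A :=
  CFC.sqrt_mul_sqrt_self A (Matrix.nonneg_iff_posSemidef.2 hA)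

theorem sqrt_eq_of_mul_self {A B : Matrix n n ℂ} (hB : B.PosSemidef) (h : B * B = A) :
    CFC.sqrt A = B :=
  CFC.sqrt_unique h (Matrix.nonneg_iff_posSemidef.2 hB)

theorem conj_mul_conj {U : Matrix n n ℂ} (hU : U ∈ Matrix.unitaryGroup n ℂ)
    (A B : Matrix n n ℂ) :
    U * A * U.conjTranspose * (U * B * U.conjTranspose) = U * (A * B) * U.conjTranspose := by
  have h : U.conjTranspose * U = 1 := Matrix.mem_unitaryGroup_iff'.1 hU
  calc _ = U * A * (U.conjTranspose * U) * B * U.conjTranspose := by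
        simp only [Matrix.mul_assoc]
    _ = _ := by rw [h, Matrix.mul_one]; simp only [Matrix.mul_assoc]

theorem trace_conj {U : Matrix n n ℂ} (hU : U ∈ Matrix.unitaryGroup n ℂ) (A : Matrix n n ℂ) :
    (U * A * U.conjTranspose).trace = A.trace := by
  have h : U.conjTranspose * U = 1 := Matrix.mem_unitaryGroup_iff'.1 hU
  rw [Matrix.trace_mul_comm, ← Matrix.mul_assoc, h, Matrix.one_mul]

theorem sqrt_conj {U : Matrix n n ℂ} (hU : U ∈ Matrix.unitaryGroup n ℂ) {A : Matrix n n ℂ}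
    (hA : A.PosSemidef) :
    CFC.sqrt (U * A * U.conjTranspose) = U * CFC.sqrt A * U.conjTranspose :=
  sqrt_eq_of_mul_self ((posSemidef_sqrt A).mul_mul_conjTranspose_same U)
    (by rw [conj_mul_conj hU, sqrt_mul_sqrt hA])

theorem traceNorm_conj {U : Matrix n n ℂ} (hU : U ∈ Matrix.unitaryGroup n ℂ)
    (A : Matrix n n ℂ) : traceNorm (U * A * U.conjTranspose) = traceNorm A := by
  have h : (U * A * U.conjTranspose).conjTranspose = U * A.conjTranspose * U.conjTranspose := by
    simp [Matrix.conjTranspose_mul, Matrix.mul_assoc]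
  rw [traceNorm, h, conj_mul_conj hU, sqrt_conj hU (Matrix.posSemidef_conjTranspose_mul_self A),
    trace_conj hU, traceNorm]

theorem fidelity_conj {U : Matrix n n ℂ} (hU : U ∈ Matrix.unitaryGroup n ℂ)
    {A B : Matrix n n ℂ} (hA : A.PosSemidef) (hB : B.PosSemidef) :
    fidelity (U * A * U.conjTranspose) (U * B * U.conjTranspose) = fidelity A B := by
  rw [fidelity, sqrt_conj hU hA, sqrt_conj hU hB, conj_mul_conj hU, traceNorm_conj hU, fidelity]

theorem re_trace_le_traceNorm (A : Matrix n n ℂ) : A.trace.re ≤ traceNorm A := by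
  have hP := posSemidef_sqrt (A.conjTranspose * A)
  have hPP := sqrt_mul_sqrt (Matrix.posSemidef_conjTranspose_mul_self A)
  unfold traceNorm
  generalize CFC.sqrt (A.conjTranspose * A) = P at hP hPP ⊢
  obtain ⟨V, hV, hPV⟩ := exists_unitary_diagonal hP.isHermitian
  have hs := hP.eigenvalues_nonneg
  generalize hP.isHermitian.eigenvalues = s at hPV hs
  have hV' : V.conjTranspose ∈ Matrix.unitaryGroup n ℂ := Unitary.star_mem hV
  have h1 : V.conjTranspose * V = 1 := Matrix.mem_unitaryGroup_iff'.1 hV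
  obtain ⟨B, rfl⟩ : ∃ B, A = V * B * V.conjTranspose := by
    refine ⟨V.conjTranspose * A * V, ?_⟩
    have h2 : V * V.conjTranspose = 1 := Matrix.mem_unitaryGroup_iff.1 hV
    rw [← Matrix.mul_assoc, ← Matrix.mul_assoc, h2, Matrix.one_mul, Matrix.mul_assoc, h2,
      Matrix.mul_one]
  have h : (V * B * V.conjTranspose).conjTranspose = V * B.conjTranspose * V.conjTranspose := by
    simp [Matrix.conjTranspose_mul, Matrix.mul_assoc]
  rw [h, conj_mul_conj hV, hPV, conj_mul_conj hV] at hPP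
  have hBB : B.conjTranspose * B = Matrix.diagonal fun k => ((s k * s k : ℝ) : ℂ) := by
    have := congrArg (fun X => V.conjTranspose * X * V) hPP
    simp only [← Matrix.mul_assoc, h1, Matrix.one_mul] at this
    simp only [Matrix.mul_assoc, h1, Matrix.mul_one] at this
    rw [← this, Matrix.diagonal_mul_diagonal]
    simp
  rw [hPV, trace_conj hV, trace_conj hV, Matrix.trace, Matrix.trace, Complex.re_sum,
    Complex.re_sum]
  refine Finset.sum_le_sum fun i _ => ?_
  have hi : (∑ j, Complex.normSq (B j i)) = s i * s i := by
    have := congrFun (congrFun hBB i) i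
    rw [Matrix.mul_apply, Matrix.diagonal_apply_eq] at this
    simp only [Matrix.conjTranspose_apply, RCLike.star_def, ← Complex.normSq_eq_conj_mul_self]
      at this
    exact_mod_cast this
  have hle : Complex.normSq (B i i) ≤ s i * s i := by
    rw [← hi]
    exact Finset.single_le_sum (f := fun j => Complex.normSq (B j i))
      (fun j _ => Complex.normSq_nonneg _) (Finset.mem_univ i)
  rw [Matrix.diag_apply, Matrix.diag_apply, Matrix.diagonal_apply_eq, Complex.ofReal_re]
  refine le_of_sq_le_sq ?_ (hs i)
  rw [Complex.normSq_apply] at hle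
  nlinarith [mul_self_nonneg (B i i).im]

end Sqrt

theorem exp_conj_diagonal {U : Matrix n n ℂ} (hU : U ∈ Matrix.unitaryGroup n ℂ)
    (c : ℂ) (d : n → ℂ) :
    NormedSpace.exp (c • (U * Matrix.diagonal d * U.conjTranspose)) =
      U * Matrix.diagonal (fun k => Complex.exp (c * d k)) * U.conjTranspose := by
  have h2 : U * U.conjTranspose = 1 := Matrix.mem_unitaryGroup_iff.1 hU
  have hinv : U⁻¹ = U.conjTranspose := Matrix.inv_eq_right_inv h2
  have hu : IsUnit U := IsUnit.of_mul_eq_one _ h2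
  rw [← hinv, ← Matrix.smul_mul, ← Matrix.mul_smul, Matrix.exp_conj _ _ hu, ← Matrix.diagonal_smul,
    Matrix.exp_diagonal]
  congr 3
  ext k
  simp [Pi.coe_exp, Complex.exp_eq_exp_ℂ]

section Channel

open scoped MatrixOrder Matrix.Norms.L2Operator

theorem CPTPMap.posSemidef_map (Φ : CPTPMap n) {X : Matrix n n ℂ} (hX : X.PosSemidef) :
    (Φ X).PosSemidef :=
  Matrix.nonneg_iff_posSemidef.1
    (map_nonneg Φ.toCompletelyPositiveMap (Matrix.nonneg_iff_posSemidef.2 hX))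

theorem CPTPMap.trace_map (Φ : CPTPMap n) (X : Matrix n n ℂ) : (Φ X).trace = X.trace :=
  Φ.trace_map' X

theorem le_sqrt_of_mul_self_le {A B : Matrix n n ℂ} (hA : A.PosSemidef)
    (h : (B - A * A).PosSemidef) : (CFC.sqrt B - A).PosSemidef := by
  have := CFC.sqrt_le_sqrt (A * A) B (Matrix.le_iff.2 h)
  rw [sqrt_eq_of_mul_self hA rfl] at this
  exact Matrix.le_iff.1 this

end Channel

theorem traceDual_posSemidef (Φ : CPTPMap n) {Y : Matrix n n ℂ} (hY : Y.PosSemidef) :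
    (traceDual Φ.toLin Y).PosSemidef := by
  refine posSemidef_of_dotProduct_nonneg fun x => ?_
  have := trace_mul_nonneg (Φ.posSemidef_map (Matrix.posSemidef_vecMulVec_self_star x)) hY
  rw [trace_map_mul, Matrix.vecMulVec_mul, Matrix.trace_vecMulVec] at this
  rwa [Matrix.dotProduct_mulVec, dotProduct_comm]

theorem traceDual_one (Φ : CPTPMap n) : traceDual Φ.toLin 1 = 1 := by
  ext i j
  simp only [traceDual, LinearMap.coe_mk, AddHom.coe_mk, Matrix.of_apply, Matrix.mul_one,
    Φ.trace_map]
  by_cases h : i = j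
  · subst h; simp
  · rw [Matrix.trace_single_eq_of_ne _ _ _ (Ne.symm h), Matrix.one_apply_ne h]

/-- The matrix with eigenvector matrix `U` and real eigenvalues `d`. -/
def unitaryDiag (U : Matrix n n ℂ) (d : n → ℝ) : Matrix n n ℂ :=
  U * Matrix.diagonal (fun k => (d k : ℂ)) * U.conjTranspose

theorem unitaryDiag_posSemidef (U : Matrix n n ℂ) {d : n → ℝ} (hd : ∀ k, 0 ≤ d k) :
    (unitaryDiag U d).PosSemidef :=
  (Matrix.PosSemidef.diagonal fun k => Complex.zero_le_real.2 (hd k)).mul_mul_conjTranspose_same U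

theorem unitaryDiag_single_posSemidef (U : Matrix n n ℂ) (k : n) :
    (unitaryDiag U (Pi.single k 1)).PosSemidef :=
  unitaryDiag_posSemidef U fun _ => by rw [Pi.single_apply]; split_ifs <;> norm_num

theorem unitaryDiag_eq_sum (U : Matrix n n ℂ) (d : n → ℝ) :
    unitaryDiag U d = ∑ k, (d k : ℂ) • unitaryDiag U (Pi.single k 1) := by
  have h : ∀ c : ℂ, ∀ D : Matrix n n ℂ,
      c • (U * D * U.conjTranspose) = U * (c • D) * U.conjTranspose := fun c D => by
    rw [Matrix.mul_smul, Matrix.smul_mul]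
  simp only [unitaryDiag, h]
  rw [← Finset.sum_mul, ← Finset.mul_sum]
  congr 2
  ext i j
  rw [Matrix.sum_apply]
  by_cases h : i = j
  · subst h
    simp [Pi.single_apply, apply_ite Complex.ofReal]
  · simp [Matrix.diagonal_apply_ne _ h]

theorem unitaryDiag_mul {U : Matrix n n ℂ} (hU : U ∈ Matrix.unitaryGroup n ℂ) (c d : n → ℝ) :
    unitaryDiag U c * unitaryDiag U d = unitaryDiag U fun k => c k * d k := by
  rw [unitaryDiag, unitaryDiag, conj_mul_conj hU, Matrix.diagonal_mul_diagonal, unitaryDiag]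
  simp

theorem unitaryDiag_one {U : Matrix n n ℂ} (hU : U ∈ Matrix.unitaryGroup n ℂ) :
    unitaryDiag U 1 = 1 := by
  simp only [unitaryDiag, Pi.one_apply, Complex.ofReal_one, Matrix.diagonal_one, Matrix.mul_one]
  exact Matrix.mem_unitaryGroup_iff.1 hU

theorem trace_unitaryDiag {U : Matrix n n ℂ} (hU : U ∈ Matrix.unitaryGroup n ℂ) (d : n → ℝ) :
    (unitaryDiag U d).trace = ((∑ k, d k : ℝ) : ℂ) := by
  rw [unitaryDiag, trace_conj hU, Matrix.trace_diagonal]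
  simp

open scoped MatrixOrder in
theorem sqrt_unitaryDiag {U : Matrix n n ℂ} (hU : U ∈ Matrix.unitaryGroup n ℂ) {d : n → ℝ}
    (hd : ∀ k, 0 ≤ d k) : CFC.sqrt (unitaryDiag U d) = unitaryDiag U fun k => √(d k) :=
  sqrt_eq_of_mul_self (unitaryDiag_posSemidef U fun _ => Real.sqrt_nonneg _) (by
    rw [unitaryDiag_mul hU]
    simp only [Real.mul_self_sqrt (hd _)])

/-- `β (F - H)` in the eigenbasis of `H`. -/
theorem unitaryDiag_affine {U : Matrix n n ℂ} (hU : U ∈ Matrix.unitaryGroup n ℂ)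
    (β F : ℝ) (h : n → ℝ) :
    (β : ℂ) • ((F : ℂ) • (1 : Matrix n n ℂ) - unitaryDiag U h) =
      unitaryDiag U fun k => β * (F - h k) := by
  have h1 : (F : ℂ) • (1 : Matrix n n ℂ) = U * (F : ℂ) • 1 * U.conjTranspose := by
    rw [Matrix.mul_smul, Matrix.smul_mul, Matrix.mul_one,
      show U * U.conjTranspose = 1 from Matrix.mem_unitaryGroup_iff.1 hU]
  rw [h1, unitaryDiag, ← Matrix.sub_mul, ← Matrix.mul_sub, ← Matrix.smul_mul, ← Matrix.mul_smul,
    unitaryDiag]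
  congr 2
  ext i j
  by_cases hij : i = j
  · subst hij; simp
  · simp [Matrix.diagonal_apply_ne _ hij, Matrix.one_apply_ne hij]

theorem exp_unitaryDiag {U : Matrix n n ℂ} (hU : U ∈ Matrix.unitaryGroup n ℂ) (d : n → ℝ) :
    NormedSpace.exp (unitaryDiag U d) = unitaryDiag U fun k => Real.exp (d k) := by
  have h := exp_conj_diagonal hU 1 fun k => (d k : ℂ)
  rw [one_smul] at h
  rw [unitaryDiag, h, unitaryDiag]
  simp

theorem gibbs_unitaryDiag {U : Matrix n n ℂ} (hU : U ∈ Matrix.unitaryGroup n ℂ) (β : ℝ)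
    (h : n → ℝ) : gibbs β (unitaryDiag U h) =
      unitaryDiag U fun k => Real.exp (β * (freeEnergy β (unitaryDiag U h) - h k)) := by
  rw [gibbs, unitaryDiag_affine hU, exp_unitaryDiag hU]

theorem sum_gibbs_eq_one [Nonempty n] {U : Matrix n n ℂ} (hU : U ∈ Matrix.unitaryGroup n ℂ)
    {β : ℝ} (hβ : β ≠ 0) (h : n → ℝ) :
    ∑ k, Real.exp (β * (freeEnergy β (unitaryDiag U h) - h k)) = 1 := by
  have he : -(β : ℂ) • unitaryDiag U h = unitaryDiag U fun k => β * (0 - h k) := by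
    rw [← unitaryDiag_affine hU]; simp
  have hZ : 0 < ∑ k, Real.exp (β * (0 - h k)) :=
    Finset.sum_pos (fun _ _ => Real.exp_pos _) Finset.univ_nonempty
  rw [freeEnergy, he, exp_unitaryDiag hU, trace_unitaryDiag hU, Complex.ofReal_re]
  generalize hZd : ∑ k, Real.exp (β * (0 - h k)) = Z at hZ
  have : ∀ k, Real.exp (β * (-β⁻¹ * Real.log Z - h k)) = Z⁻¹ * Real.exp (β * (0 - h k)) := by
    intro k
    have : β * (-β⁻¹ * Real.log Z - h k) = -Real.log Z + β * (0 - h k) := by field_simp; ring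
    rw [this, Real.exp_add, Real.exp_neg, Real.exp_log hZ]
  simp only [this]
  rw [← Finset.mul_sum, hZd, inv_mul_cancel₀ hZ.ne']

/-- The variance of a real observable with respect to a positive operator-valued measure is
nonnegative. -/
theorem sum_mul_self_le_of_sum_eq_one {E : n → Matrix n n ℂ} (hE : ∀ k, (E k).PosSemidef)
    (h1 : ∑ k, E k = 1) (d : n → ℝ) :
    (∑ k, ((d k * d k : ℝ) : ℂ) • E k -
      (∑ k, (d k : ℂ) • E k) * ∑ k, (d k : ℂ) • E k).PosSemidef := by
  obtain ⟨M, hMd⟩ : ∃ M, M = ∑ k, (d k : ℂ) • E k := ⟨_, rfl⟩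
  have hM : M.IsHermitian := by
    rw [hMd, Matrix.IsHermitian, Matrix.conjTranspose_sum]
    refine Finset.sum_congr rfl fun k _ => ?_
    rw [Matrix.conjTranspose_smul, (hE k).isHermitian.eq]
    simp
  have key : ∑ k, ((d k * d k : ℝ) : ℂ) • E k - M * M =
      ∑ k, ((d k : ℂ) • (1 : Matrix n n ℂ) - M) * E k *
        ((d k : ℂ) • (1 : Matrix n n ℂ) - M).conjTranspose := by
    have hs : ∀ k, ((d k : ℂ) • (1 : Matrix n n ℂ) - M).conjTranspose =
        (d k : ℂ) • (1 : Matrix n n ℂ) - M := fun k => by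
      rw [Matrix.conjTranspose_sub, Matrix.conjTranspose_smul, hM.eq]; simp
    have ht : ∀ k, ((d k : ℂ) • (1 : Matrix n n ℂ) - M) * E k * ((d k : ℂ) • 1 - M) =
        ((d k * d k : ℝ) : ℂ) • E k - M * ((d k : ℂ) • E k) - ((d k : ℂ) • E k) * M +
          M * E k * M := fun k => by
      simp only [Matrix.sub_mul, Matrix.mul_sub, Matrix.smul_mul, Matrix.mul_smul,
        Matrix.one_mul, Matrix.mul_one, smul_sub, smul_smul, Complex.ofReal_mul]
      abel
    simp only [hs, ht, Finset.sum_add_distrib, Finset.sum_sub_distrib]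
    rw [← Finset.sum_mul, ← Finset.sum_mul, ← Finset.mul_sum, ← Finset.mul_sum, h1, ← hMd,
      Matrix.mul_one]
    abel
  rw [← hMd, key]
  exact Matrix.posSemidef_sum _ fun k _ => (hE k).mul_mul_conjTranspose_same _

/-- Kadison's inequality for the trace-dual of a channel. -/
theorem traceDual_mul_self_le (Φ : CPTPMap n) {U : Matrix n n ℂ}
    (hU : U ∈ Matrix.unitaryGroup n ℂ) (d : n → ℝ) :
    (traceDual Φ.toLin (unitaryDiag U fun k => d k * d k) -
      traceDual Φ.toLin (unitaryDiag U d) * traceDual Φ.toLin (unitaryDiag U d)).PosSemidef := by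
  have hd : ∀ d : n → ℝ, traceDual Φ.toLin (unitaryDiag U d) =
      ∑ k, (d k : ℂ) • traceDual Φ.toLin (unitaryDiag U (Pi.single k 1)) := fun d => by
    conv_lhs => rw [unitaryDiag_eq_sum, map_sum]
    simp only [map_smul]
  have h1 : ∑ k, traceDual Φ.toLin (unitaryDiag U (Pi.single k 1)) = 1 := by
    have := hd 1
    rw [unitaryDiag_one hU, traceDual_one] at this
    simpa using this.symm
  rw [hd d, hd fun k => d k * d k]
  exact sum_mul_self_le_of_sum_eq_one
    (fun k => traceDual_posSemidef Φ (unitaryDiag_single_posSemidef U k)) h1 d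

open scoped MatrixOrder in
theorem traceDual_sqrt_le (Φ : CPTPMap n) {U : Matrix n n ℂ}
    (hU : U ∈ Matrix.unitaryGroup n ℂ) {d : n → ℝ} (hd : ∀ k, 0 ≤ d k) :
    (CFC.sqrt (traceDual Φ.toLin (unitaryDiag U d)) -
      traceDual Φ.toLin (unitaryDiag U fun k => √(d k))).PosSemidef := by
  refine le_sqrt_of_mul_self_le
    (traceDual_posSemidef Φ (unitaryDiag_posSemidef U fun k => Real.sqrt_nonneg _)) ?_
  have := traceDual_mul_self_le Φ hU fun k => √(d k)
  simpa only [Real.mul_self_sqrt (hd _)] using this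

/-- The relative-entropy difference bounds the overlap of the square roots (Jensen's inequality
for the exponential function). -/
theorem exp_neg_half_le_trace_sqrt_mul (Φ : CPTPMap n) {U V : Matrix n n ℂ}
    (hU : U ∈ Matrix.unitaryGroup n ℂ) (hV : V ∈ Matrix.unitaryGroup n ℂ) {x y : n → ℝ}
    (hx : ∑ i, Real.exp (x i) = 1) :
    Real.exp (-((unitaryDiag U (fun i => Real.exp (x i)) * unitaryDiag U x).trace.re -
        (Φ (unitaryDiag U fun i => Real.exp (x i)) * unitaryDiag V y).trace.re) / 2) ≤
      (unitaryDiag U (fun i => √(Real.exp (x i))) *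
        traceDual Φ.toLin (unitaryDiag V fun k => √(Real.exp (y k)))).trace.re := by
  set a : n → n → ℝ := fun i k =>
    (Φ (unitaryDiag U (Pi.single i 1)) * unitaryDiag V (Pi.single k 1)).trace.re with ha
  have hbil : ∀ c d : n → ℝ, (Φ (unitaryDiag U c) * unitaryDiag V d).trace.re =
      ∑ i, ∑ k, c i * d k * a i k := fun c d => by
    rw [unitaryDiag_eq_sum U c, unitaryDiag_eq_sum V d, map_sum]
    simp only [map_smul, Matrix.sum_mul, Matrix.smul_mul, Matrix.mul_smul,
      Matrix.trace_sum, Matrix.trace_smul, smul_eq_mul, Complex.re_sum, Complex.re_ofReal_mul, ha,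
      mul_assoc, Finset.mul_sum]
    rw [Finset.sum_comm]
    exact Finset.sum_congr rfl fun i _ => Finset.sum_congr rfl fun k _ => mul_left_comm _ _ _
  have ha0 : ∀ i k, 0 ≤ a i k := fun i k =>
    (Complex.nonneg_iff.1 (trace_mul_nonneg (Φ.posSemidef_map (unitaryDiag_single_posSemidef U i))
      (unitaryDiag_single_posSemidef V k))).1
  have hmarg : ∀ i, ∑ k, a i k = 1 := fun i => by
    have := hbil (Pi.single i 1) 1
    rw [unitaryDiag_one hV, Matrix.mul_one, Φ.trace_map, trace_unitaryDiag hU] at this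
    simp only [Pi.single_apply, Pi.one_apply, mul_one, ite_mul, one_mul, zero_mul,
      Finset.sum_ite_irrel, Finset.sum_const_zero, Finset.sum_ite_eq', Finset.mem_univ, if_true]
      at this
    rw [← this]
    simp
  have hent : (unitaryDiag U (fun i => Real.exp (x i)) * unitaryDiag U x).trace.re =
      ∑ i, ∑ k, Real.exp (x i) * a i k * x i := by
    rw [unitaryDiag_mul hU, trace_unitaryDiag hU, Complex.ofReal_re]
    refine Finset.sum_congr rfl fun i _ => ?_
    rw [← Finset.sum_mul, ← Finset.mul_sum, hmarg, mul_one]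
  rw [← trace_map_mul, hent]
  change Real.exp (-(_ - (Φ _ * _).trace.re) / 2) ≤ (Φ _ * _).trace.re
  rw [hbil, hbil]
  have hJ := convexOn_exp.map_sum_le (t := (Finset.univ : Finset (n × n)))
    (w := fun q => Real.exp (x q.1) * a q.1 q.2) (p := fun q => (y q.2 - x q.1) / 2)
    (fun q _ => mul_nonneg (Real.exp_pos _).le (ha0 _ _))
    (by
      rw [Fintype.sum_prod_type]
      simp only [← Finset.mul_sum, hmarg, mul_one, hx])
    (fun _ _ => Set.mem_univ _)
  simp only [Fintype.sum_prod_type, smul_eq_mul] at hJ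
  refine (le_of_eq ?_).trans (hJ.trans (le_of_eq ?_))
  · congr 1
    rw [← Finset.sum_sub_distrib, ← Finset.sum_neg_distrib, Finset.sum_div]
    refine Finset.sum_congr rfl fun i _ => ?_
    rw [← Finset.sum_sub_distrib, ← Finset.sum_neg_distrib, Finset.sum_div]
    refine Finset.sum_congr rfl fun k _ => ?_
    ring
  · refine Finset.sum_congr rfl fun i _ => Finset.sum_congr rfl fun k _ => ?_
    rw [← Real.exp_half, ← Real.exp_half, ← Real.exp_add, mul_right_comm, ← Real.exp_add]
    congr 2
    ring

theorem gibbs_spectral [Nonempty n] {β : ℝ} (hβ : β ≠ 0) {H : Matrix n n ℂ}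
    (hH : H.IsHermitian) : ∃ U ∈ Matrix.unitaryGroup n ℂ, ∃ x : n → ℝ,
      gibbs β H = unitaryDiag U (fun i => Real.exp (x i)) ∧ ∑ i, Real.exp (x i) = 1 ∧
      unitaryDiag U x = (β : ℂ) • ((freeEnergy β H : ℂ) • (1 : Matrix n n ℂ) - H) := by
  obtain ⟨U, hU, hUH⟩ := exists_unitary_diagonal hH
  change H = unitaryDiag U _ at hUH
  generalize hH.eigenvalues = h at hUH
  subst hUH
  exact ⟨U, hU, _, gibbs_unitaryDiag hU β h, sum_gibbs_eq_one hU hβ h,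
    (unitaryDiag_affine hU β _ h).symm⟩

theorem gibbs_isDensity [Nonempty n] {β : ℝ} (hβ : β ≠ 0) {H : Matrix n n ℂ}
    (hH : H.IsHermitian) : IsDensity (gibbs β H) := by
  obtain ⟨U, hU, x, h, hx, -⟩ := gibbs_spectral hβ hH
  rw [h]
  exact ⟨unitaryDiag_posSemidef U fun i => (Real.exp_pos _).le,
    by rw [trace_unitaryDiag hU, hx, Complex.ofReal_one]⟩

section Fidelity

open scoped MatrixOrder

theorem trace_sqrt_mul_sqrt_le_one {ρ σ : Matrix n n ℂ} (hρ : IsDensity ρ) (hσ : IsDensity σ) :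
    (CFC.sqrt ρ * CFC.sqrt σ).trace.re ≤ 1 := by
  have h := (Matrix.posSemidef_conjTranspose_mul_self (CFC.sqrt ρ - CFC.sqrt σ)).trace_nonneg
  rw [Matrix.conjTranspose_sub, (posSemidef_sqrt ρ).isHermitian.eq,
    (posSemidef_sqrt σ).isHermitian.eq, Matrix.sub_mul, Matrix.mul_sub, Matrix.mul_sub,
    sqrt_mul_sqrt hρ.1, sqrt_mul_sqrt hσ.1, Matrix.trace_sub, Matrix.trace_sub, Matrix.trace_sub,
    hρ.2, hσ.2, Matrix.trace_mul_comm (CFC.sqrt σ)] at h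
  have := (Complex.nonneg_iff.1 h).1
  simp only [Complex.sub_re, Complex.one_re] at this
  linarith

theorem sqrt_smul {t : ℝ} (ht : 0 ≤ t) {A : Matrix n n ℂ} (hA : A.PosSemidef) :
    CFC.sqrt ((t : ℂ) • A) = ((√t : ℝ) : ℂ) • CFC.sqrt A := by
  refine sqrt_eq_of_mul_self
    ((posSemidef_sqrt A).smul (Complex.zero_le_real.2 (Real.sqrt_nonneg t))) ?_
  rw [Matrix.smul_mul, Matrix.mul_smul, sqrt_mul_sqrt hA, smul_smul, ← Complex.ofReal_mul,
    Real.mul_self_sqrt ht]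

theorem exp_neg_half_excessEnergy_le [Nonempty n] (Φ : CPTPMap n) {β : ℝ} (hβ : β ≠ 0)
    {H₀ Hτ : Matrix n n ℂ} (hH₀ : H₀.IsHermitian) (hHτ : Hτ.IsHermitian) :
    Real.exp (-(β * excessEnergy Φ β H₀ Hτ) / 2) ≤
      (CFC.sqrt (gibbs β H₀) * CFC.sqrt (traceDual Φ.toLin (gibbs β Hτ))).trace.re := by
  have hd₀ := gibbs_isDensity hβ hH₀
  have hlog : ∀ (ρ H : Matrix n n ℂ) (F : ℝ), ρ.trace = 1 →
      (ρ * ((β : ℂ) • ((F : ℂ) • (1 : Matrix n n ℂ) - H))).trace.re =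
        β * (F - energy ρ H) := fun ρ H F hρ => by
    rw [Matrix.mul_smul, Matrix.mul_sub, Matrix.mul_smul, Matrix.mul_one, Matrix.trace_smul,
      Matrix.trace_sub, Matrix.trace_smul, hρ, energy]
    simp
  have hent : β * excessEnergy Φ β H₀ Hτ =
      β * (freeEnergy β H₀ - energy (gibbs β H₀) H₀) -
        β * (freeEnergy β Hτ - energy (Φ (gibbs β H₀)) Hτ) := by
    rw [excessEnergy]; ring
  rw [hent, ← hlog _ _ _ hd₀.2, ← hlog _ _ _ ((Φ.trace_map _).trans hd₀.2)]
  obtain ⟨U, hU, x, h₀, hx, hx'⟩ := gibbs_spectral hβ hH₀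
  obtain ⟨V, hV, y, hτ, -, hy'⟩ := gibbs_spectral hβ hHτ
  rw [← hx', ← hy', h₀, hτ, sqrt_unitaryDiag hU fun i => (Real.exp_pos _).le]
  refine (exp_neg_half_le_trace_sqrt_mul Φ hU hV hx).trans ?_
  have h := trace_mul_nonneg (unitaryDiag_posSemidef U fun i => Real.sqrt_nonneg (Real.exp (x i)))
    (traceDual_sqrt_le Φ hV fun k => (Real.exp_pos (y k)).le)
  rw [Matrix.mul_sub, Matrix.trace_sub] at h
  have := (Complex.nonneg_iff.1 h).1
  rw [Complex.sub_re] at this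
  linarith

theorem trace_traceDual_gibbs_pos [Nonempty n] (Φ : CPTPMap n) {β : ℝ} (hβ : β ≠ 0)
    {Hτ : Matrix n n ℂ} (hHτ : Hτ.IsHermitian) :
    0 < (traceDual Φ.toLin (gibbs β Hτ)).trace := by
  have hG := traceDual_posSemidef Φ (gibbs_isDensity hβ hHτ).1
  refine lt_of_le_of_ne hG.trace_nonneg fun h => ?_
  have hle := exp_neg_half_excessEnergy_le Φ hβ hHτ hHτ
  rw [hG.trace_eq_zero_iff.1 h.symm, CFC.sqrt_zero, Matrix.mul_zero, Matrix.trace_zero,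
    Complex.zero_re] at hle
  exact absurd hle (not_le.2 (Real.exp_pos _))

theorem retrodicted_isDensity [Nonempty n] (Φ : CPTPMap n) {β : ℝ} (hβ : β ≠ 0)
    {Hτ : Matrix n n ℂ} (hHτ : Hτ.IsHermitian) : IsDensity (retrodicted Φ (gibbs β Hτ)) := by
  have hT := trace_traceDual_gibbs_pos Φ hβ hHτ
  refine ⟨(traceDual_posSemidef Φ (gibbs_isDensity hβ hHτ).1).smul (inv_nonneg.2 hT.le), ?_⟩
  rw [retrodicted, Matrix.trace_smul, smul_eq_mul, inv_mul_cancel₀ hT.ne']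

theorem buresAngle_retrodicted_le [Nonempty n] (Φ : CPTPMap n) {β : ℝ} (hβ : β ≠ 0)
    {H₀ Hτ : Matrix n n ℂ} (hH₀ : H₀.IsHermitian) (hHτ : Hτ.IsHermitian) :
    8 / Real.pi ^ 2 * buresAngle (gibbs β H₀) (retrodicted Φ (gibbs β Hτ)) ^ 2
        - Real.log (traceDual Φ.toLin (gibbs β Hτ)).trace.re
      ≤ β * excessEnergy Φ β H₀ Hτ := by
  have hG := traceDual_posSemidef Φ (gibbs_isDensity hβ hHτ).1
  have hle := exp_neg_half_excessEnergy_le Φ hβ hH₀ hHτ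
  have hone := trace_sqrt_mul_sqrt_le_one (gibbs_isDensity hβ hH₀)
    (retrodicted_isDensity Φ hβ hHτ)
  have hfid : (CFC.sqrt (gibbs β H₀) * CFC.sqrt (retrodicted Φ (gibbs β Hτ))).trace.re ≤
      fidelity (gibbs β H₀) (retrodicted Φ (gibbs β Hτ)) := re_trace_le_traceNorm _
  obtain ⟨hT, hTi⟩ := Complex.pos_iff.1 (trace_traceDual_gibbs_pos Φ hβ hHτ)
  obtain ⟨t, ht⟩ : ∃ t : ℝ, (traceDual Φ.toLin (gibbs β Hτ)).trace = t :=
    ⟨_, Complex.ext rfl hTi.symm⟩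
  have hc : (CFC.sqrt (gibbs β H₀) * CFC.sqrt (retrodicted Φ (gibbs β Hτ))).trace.re =
      (CFC.sqrt (gibbs β H₀) * CFC.sqrt (traceDual Φ.toLin (gibbs β Hτ))).trace.re / √t := by
    rw [ht, Complex.ofReal_re] at hT
    rw [retrodicted, ht, ← Complex.ofReal_inv, sqrt_smul (inv_nonneg.2 hT.le) hG, Matrix.mul_smul,
      Matrix.trace_smul, smul_eq_mul, Complex.re_ofReal_mul, Real.sqrt_inv, inv_mul_eq_div]
  rw [ht, Complex.ofReal_re] at hT ⊢
  have hpos := (Real.exp_pos _).trans_le hle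
  have hlog := (Real.le_log_iff_exp_le hpos).2 hle
  rw [hc] at hone hfid
  have := arccos_sq_le_neg_two_log (div_pos hpos (Real.sqrt_pos.2 hT)) hone hfid
  rw [Real.log_div hpos.ne' (Real.sqrt_pos.2 hT).ne', Real.log_sqrt hT.le] at this
  rw [buresAngle]
  linarith

theorem traceDual_unitary {Φ : CPTPMap n} {U : Matrix n n ℂ}
    (hΦ : ∀ X, Φ X = U * X * U.conjTranspose) (Y : Matrix n n ℂ) :
    traceDual Φ.toLin Y = U.conjTranspose * Y * U := by
  refine Matrix.ext_iff_trace_mul_left.2 fun X => ?_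
  rw [← trace_map_mul, hΦ, Matrix.mul_assoc, Matrix.mul_assoc, Matrix.trace_mul_comm]
  simp only [Matrix.mul_assoc]

theorem trace_traceDual_of_unital {Φ : CPTPMap n} (h : Φ 1 = 1) (Y : Matrix n n ℂ) :
    (traceDual Φ.toLin Y).trace = Y.trace := by
  have := trace_map_mul Φ.toLin 1 Y
  rw [h, Matrix.one_mul, Matrix.one_mul] at this
  exact this.symm

theorem retrodicted_of_unital {Φ : CPTPMap n} (h : Φ 1 = 1) {Y : Matrix n n ℂ}
    (hY : Y.trace = 1) : retrodicted Φ Y = traceDual Φ.toLin Y := by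
  rw [retrodicted, trace_traceDual_of_unital h, hY, inv_one, one_smul]

end Fidelity

end QThermo

theorem mainTheorem2 {n : Type*} [Fintype n] [DecidableEq n] [Nonempty n]
    (Φ : CPTPMap n) (β : ℝ) (hβ : 0 < β)
    (H₀ Hτ : Matrix n n ℂ) (hH₀ : H₀.IsHermitian) (hHτ : Hτ.IsHermitian) :
    -- the retrodicted state is a well-defined density matrix
    (0 < (traceDual Φ.toLin (gibbs β Hτ)).trace ∧
      IsDensity (retrodicted Φ (gibbs β Hτ))) ∧
    -- the bound for an arbitrary channel
    8 / Real.pi ^ 2 * buresAngle (gibbs β H₀) (retrodicted Φ (gibbs β Hτ)) ^ 2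
        - Real.log (traceDual Φ.toLin (gibbs β Hτ)).trace.re
      ≤ β * excessEnergy Φ β H₀ Hτ ∧
    -- unitary processes: the right-hand side becomes that of the bound for closed processes
    (∀ U ∈ Matrix.unitaryGroup n ℂ, (∀ X, Φ X = U * X * U.conjTranspose) →
      8 / Real.pi ^ 2 * buresAngle (gibbs β H₀) (retrodicted Φ (gibbs β Hτ)) ^ 2
          - Real.log (traceDual Φ.toLin (gibbs β Hτ)).trace.re
        = 8 / Real.pi ^ 2 * buresAngle (Φ (gibbs β H₀)) (gibbs β Hτ) ^ 2 ∧
      8 / Real.pi ^ 2 * buresAngle (Φ (gibbs β H₀)) (gibbs β Hτ) ^ 2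
        ≤ β * excessEnergy Φ β H₀ Hτ) ∧
    -- unital channels: no normalization is needed and the logarithm disappears
    (Φ 1 = 1 →
      (traceDual Φ.toLin (gibbs β Hτ)).trace = 1 ∧
      retrodicted Φ (gibbs β Hτ) = traceDual Φ.toLin (gibbs β Hτ) ∧
      8 / Real.pi ^ 2 * buresAngle (gibbs β H₀) (traceDual Φ.toLin (gibbs β Hτ)) ^ 2
        ≤ β * excessEnergy Φ β H₀ Hτ) := by
  have hd₀ := gibbs_isDensity hβ.ne' hH₀
  have hdτ := gibbs_isDensity hβ.ne' hHτ
  have hmain := buresAngle_retrodicted_le Φ hβ.ne' hH₀ hHτ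
  refine ⟨⟨trace_traceDual_gibbs_pos Φ hβ.ne' hHτ, retrodicted_isDensity Φ hβ.ne' hHτ⟩, hmain,
    fun U hU hΦ => ?_, fun h1 => ?_⟩
  · have hUU : U * U.conjTranspose = 1 := Matrix.mem_unitaryGroup_iff.1 hU
    have h1 : Φ 1 = 1 := by rw [hΦ, Matrix.mul_one, hUU]
    have hG := (retrodicted_isDensity Φ hβ.ne' hHτ).1
    have hτ : gibbs β Hτ = U * retrodicted Φ (gibbs β Hτ) * U.conjTranspose := by
      rw [retrodicted_of_unital h1 hdτ.2, traceDual_unitary hΦ]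
      simp only [← Matrix.mul_assoc, hUU, Matrix.one_mul]
      rw [Matrix.mul_assoc, hUU, Matrix.mul_one]
    have hangle : buresAngle (Φ (gibbs β H₀)) (gibbs β Hτ) =
        buresAngle (gibbs β H₀) (retrodicted Φ (gibbs β Hτ)) := by
      conv_lhs => rw [hτ, hΦ, buresAngle, fidelity_conj hU hd₀.1 hG]
      rfl
    rw [trace_traceDual_of_unital h1, hdτ.2, Complex.one_re, Real.log_one, sub_zero] at hmain ⊢
    rw [hangle]
    exact ⟨rfl, hmain⟩
  · rw [trace_traceDual_of_unital h1, hdτ.2, Complex.one_re, Real.log_one, sub_zero,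
      retrodicted_of_unital h1 hdτ.2] at hmain
    exact ⟨(trace_traceDual_of_unital h1 _).trans hdτ.2, retrodicted_of_unital h1 hdτ.2, hmain⟩
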